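/- Let $n\ge 0$ be an integer. Let $\widetilde{\mathcal E}_n[t]$ be the associative unital algebra over $\mathbb Z[y_1,\dots,y_n]$ (so the $y_i$ are central) generated by symbols $[i,j]$ ($1\le i,j\le n$, $i\ne j$), $x_1,\dots,x_n$ and $t$, subject to the relations - $[i,j]=-[j,i]$ and $[i,j]^2=0$; - $[i,j][k,l]=[k,l][i,j]$ if $\{i,j\}\cap\{k,l\}=\emptyset$; - $[i,j][j,k]+[j,k][k,i]+[k,i][i,j]=0$ for distinct $i,j,k$; - $x_ix_j=x_jx_i$, $x_it=tx_i$ and $[i,j]t=t[i,j]$; - $[i,j]x_k=x_k[i,j]$ for $k\ne i,j$; - $[i,j]x_i=x_j[i,j]+t$ and $[i,j]x_j=x_i[i,j]-t$ for $i<j$; - $e_k(x_1,\dots,x_n)=e_k(y_1,\dots,y_n)$ for $1\le k\le n$, where $e_k$ is the $k$-th elementary symmetric polynomial, with $e_0=1$ and $e_k=0$ for $k<0$. Let $\theta_i=x_i+\sum_{j\ne i}[i,j]$ for $1\le i\le n$; these elements commute pairwise. Then for all $1\le k\le n$, in $\widetilde{\mathcal E}_n[t]$, $$e_k(\theta_1,\dots,\theta_n)=e_k(y_1,\dots,y_n)+\sum_{r\ge1}(-t)^r\,(2r-1)!!\binom{n-k+2r}{2r}\,e_{k-2r}(y_1,\dots,y_n).$$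 -/

import Mathlib

/-- The generators of the extended quadratic algebra: the symbols `[i,j]` with `i ≠ j`,
the variables `x_1, …, x_n`, and `t`. -/
inductive ExtGen (n : ℕ) : Type
  | br (i j : Fin n) (h : i ≠ j) : ExtGen n
  | x (i : Fin n) : ExtGen n
  | t : ExtGen n

/-- The ring `R = ℤ[y_1, …, y_n]`. -/
abbrev YRing (n : ℕ) : Type := MvPolynomial (Fin n) ℤ

/-- The free associative `ℤ[y_1, …, y_n]`-algebra on the generators. -/
abbrev ExtFree (n : ℕ) : Type := FreeAlgebra (YRing n) (ExtGen n)

namespace ExtFree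

/-- The symbol `[i,j]` in the free algebra. -/
noncomputable def br {n : ℕ} (i j : Fin n) (h : i ≠ j) : ExtFree n :=
  FreeAlgebra.ι (YRing n) (ExtGen.br i j h)

/-- The variable `x_i` in the free algebra. -/
noncomputable def x {n : ℕ} (i : Fin n) : ExtFree n :=
  FreeAlgebra.ι (YRing n) (ExtGen.x i)

/-- The variable `t` in the free algebra. -/
noncomputable def t {n : ℕ} : ExtFree n :=
  FreeAlgebra.ι (YRing n) ExtGen.t

/-- The word sum `∑_{i_1 < ⋯ < i_k} x_{i_1} ⋯ x_{i_k}`, which represents `e_k(x_1, …, x_n)`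
(the `x_i` commute with each other in the quotient). -/
noncomputable def esymmX (n k : ℕ) : ExtFree n :=
  ∑ s ∈ Finset.powersetCard k (Finset.univ : Finset (Fin n)),
    ((s.sort (fun a b => a ≤ b)).map x).prod

end ExtFree

open ExtFree in
/-- The defining relations of the extended quadratic algebra. -/
inductive ExtRel (n : ℕ) : ExtFree n → ExtFree n → Prop
  /-- `[i,j] = -[j,i]` -/
  | antisymm (i j : Fin n) (h : i ≠ j) : ExtRel n (br i j h) (-br j i h.symm)
  /-- `[i,j]² = 0` -/
  | sq (i j : Fin n) (h : i ≠ j) : ExtRel n (br i j h * br i j h) 0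
  /-- `[i,j][k,l] = [k,l][i,j]` if `{i,j} ∩ {k,l} = ∅` -/
  | br_comm (i j k l : Fin n) (hij : i ≠ j) (hkl : k ≠ l)
      (hik : i ≠ k) (hil : i ≠ l) (hjk : j ≠ k) (hjl : j ≠ l) :
      ExtRel n (br i j hij * br k l hkl) (br k l hkl * br i j hij)
  /-- `[i,j][j,k] + [j,k][k,i] + [k,i][i,j] = 0` -/
  | three_term (i j k : Fin n) (hij : i ≠ j) (hjk : j ≠ k) (hki : k ≠ i) :
      ExtRel n (br i j hij * br j k hjk + br j k hjk * br k i hki + br k i hki * br i j hij) 0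
  /-- `[i,j] x_k = x_k [i,j]` for `k ≠ i, j` -/
  | br_x (i j k : Fin n) (h : i ≠ j) (hki : k ≠ i) (hkj : k ≠ j) :
      ExtRel n (br i j h * x k) (x k * br i j h)
  /-- `[i,j] x_i = x_j [i,j] + t` for `i < j` -/
  | br_x_left (i j : Fin n) (h : i < j) :
      ExtRel n (br i j h.ne * x i) (x j * br i j h.ne + t)
  /-- `[i,j] x_j = x_i [i,j] - t` for `i < j` -/
  | br_x_right (i j : Fin n) (h : i < j) :
      ExtRel n (br i j h.ne * x j) (x i * br i j h.ne - t)
  /-- `[i,j] t = t [i,j]` -/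
  | br_t (i j : Fin n) (h : i ≠ j) : ExtRel n (br i j h * t) (t * br i j h)
  /-- `x_1, …, x_n, t` are the variables of the commutative ring `ℤ[x_1, …, x_n][t]`. -/
  | x_comm (i j : Fin n) : ExtRel n (x i * x j) (x j * x i)
  | x_t (i : Fin n) : ExtRel n (x i * t) (t * x i)
  /-- `e_k(x_1, …, x_n) = e_k(y_1, …, y_n)` for `1 ≤ k ≤ n` -/
  | esymm (k : ℕ) (h1 : 1 ≤ k) (hn : k ≤ n) :
      ExtRel n (esymmX n k) (algebraMap (YRing n) (ExtFree n) (MvPolynomial.esymm (Fin n) ℤ k))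

/-- The extended quadratic algebra `Ẽ_n[t]`: the associative unital `ℤ[y_1, …, y_n]`-algebra
with the above generators and relations. -/
def ExtAlg (n : ℕ) : Type := RingQuot (ExtRel n)

namespace ExtAlg

noncomputable instance (n : ℕ) : Ring (ExtAlg n) :=
  inferInstanceAs (Ring (RingQuot (ExtRel n)))

noncomputable instance (n : ℕ) : Algebra (YRing n) (ExtAlg n) :=
  inferInstanceAs (Algebra (YRing n) (RingQuot (ExtRel n)))

/-- The quotient map from the free algebra onto `Ẽ_n[t]`. -/
noncomputable def mk (n : ℕ) : ExtFree n →ₐ[YRing n] ExtAlg n :=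
  RingQuot.mkAlgHom (YRing n) (ExtRel n)

/-- The element `[i,j]` of `Ẽ_n[t]`. -/
noncomputable def br {n : ℕ} (i j : Fin n) (h : i ≠ j) : ExtAlg n :=
  mk n (ExtFree.br i j h)

/-- The element `x_i` of `Ẽ_n[t]`. -/
noncomputable def x {n : ℕ} (i : Fin n) : ExtAlg n :=
  mk n (ExtFree.x i)

/-- The element `t` of `Ẽ_n[t]`. -/
noncomputable def t {n : ℕ} : ExtAlg n :=
  mk n ExtFree.t

/-- The Dunkl element `θ_i = x_i + ∑_{j ≠ i} [i,j]`. -/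
noncomputable def dunkl {n : ℕ} (i : Fin n) : ExtAlg n :=
  x i + ∑ j : Fin n, if h : i ≠ j then br i j h else 0

theorem dunkl_commute {n : ℕ} (i j : Fin n) : Commute (dunkl i) (dunkl j) := by
  rcases eq_or_ne i j with rfl | hij
  · exact Commute.refl _
  have key : ∀ a b : ExtFree n, ExtRel n a b →
      mk n a = mk n b :=
    fun a b h => RingQuot.mkAlgHom_rel (YRing n) h
  have anti : ∀ (a b : Fin n) (h : a ≠ b), br a b h = -br b a h.symm := fun a b h => by
    simpa [br] using key _ _ (ExtRel.antisymm a b h)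
  have comm4 : ∀ (a b c d : Fin n) (hab : a ≠ b) (hcd : c ≠ d), a ≠ c → a ≠ d → b ≠ c → b ≠ d →
      br a b hab * br c d hcd = br c d hcd * br a b hab := fun a b c d hab hcd h1 h2 h3 h4 => by
    simpa [br] using key _ _ (ExtRel.br_comm a b c d hab hcd h1 h2 h3 h4)
  have three : ∀ (a b c : Fin n) (hab : a ≠ b) (hbc : b ≠ c) (hca : c ≠ a),
      br a b hab * br b c hbc + br b c hbc * br c a hca + br c a hca * br a b hab = 0 :=
    fun a b c hab hbc hca => by
      simpa [br] using key _ _ (ExtRel.three_term a b c hab hbc hca)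
  have brx : ∀ (a b c : Fin n) (h : a ≠ b), c ≠ a → c ≠ b → br a b h * x c = x c * br a b h :=
    fun a b c h h1 h2 => by simpa [br, x] using key _ _ (ExtRel.br_x a b c h h1 h2)
  have xx : x i * x j = x j * x i := by simpa [x] using key _ _ (ExtRel.x_comm i j)
  have sumlt : ∀ (a b : Fin n) (h : a < b),
      br a b h.ne * (x a + x b) = (x a + x b) * br a b h.ne := fun a b h => by
    have h1 : br a b h.ne * x a = x b * br a b h.ne + t := by
      simpa [br, x, t] using key _ _ (ExtRel.br_x_left a b h)
    have h2 : br a b h.ne * x b = x a * br a b h.ne - t := by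
      simpa [br, x, t] using key _ _ (ExtRel.br_x_right a b h)
    rw [mul_add, h1, h2, add_mul]; abel
  have sumx : br i j hij * (x i + x j) = (x i + x j) * br i j hij := by
    rcases lt_or_gt_of_ne hij with h | h
    · exact sumlt i j h
    · rw [anti i j hij, neg_mul, mul_neg, add_comm (x i), sumlt j i h]
  let B : Fin n → Fin n → ExtAlg n := fun a b => if h : a ≠ b then br a b h else 0
  have hB : ∀ (a b : Fin n) (h : a ≠ b), B a b = br a b h := fun a b h => dif_pos h
  let M : Finset (Fin n) := (Finset.univ.erase i).erase j
  have hM : ∀ m ∈ M, m ≠ j ∧ m ≠ i := fun m hm => by simpa [M] using hm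
  have di : dunkl i = x i + (B i j + ∑ m ∈ M, B i m) := by
    have h0 : B i i = 0 := by simp [B]
    rw [show dunkl i = x i + ∑ m, B i m from rfl,
      ← Finset.add_sum_erase _ _ (Finset.mem_univ i), h0, zero_add,
      ← Finset.add_sum_erase (Finset.univ.erase i) _ (Finset.mem_erase.2 ⟨hij.symm, Finset.mem_univ j⟩)]
  have dj : dunkl j = x j + (-B i j + ∑ m ∈ M, B j m) := by
    have h0 : B j j = 0 := by simp [B]
    rw [show dunkl j = x j + ∑ m, B j m from rfl,
      ← Finset.add_sum_erase _ _ (Finset.mem_univ i),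
      ← Finset.add_sum_erase (Finset.univ.erase i) _ (Finset.mem_erase.2 ⟨hij.symm, Finset.mem_univ j⟩),
      h0, zero_add, hB i j hij, hB j i hij.symm, anti j i]
  have hP : (∑ m ∈ M, B i m) * x j = x j * ∑ m ∈ M, B i m := by
    rw [Finset.sum_mul, Finset.mul_sum]
    refine Finset.sum_congr rfl fun m hm => ?_
    rw [hB i m (hM m hm).2.symm, brx _ _ _ _ hij.symm (hM m hm).1.symm]
  have hQ : (∑ m ∈ M, B j m) * x i = x i * ∑ m ∈ M, B j m := by
    rw [Finset.sum_mul, Finset.mul_sum]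
    refine Finset.sum_congr rfl fun m hm => ?_
    rw [hB j m (hM m hm).1.symm, brx _ _ _ _ hij (hM m hm).2.symm]
  have hPQ : (∑ m ∈ M, B i m) * (∑ m ∈ M, B j m) - (∑ m ∈ M, B j m) * (∑ m ∈ M, B i m)
      = ∑ m ∈ M, (B i m * B j m - B j m * B i m) := by
    rw [Finset.sum_mul_sum, Finset.sum_mul_sum, Finset.sum_comm (s := M) (t := M)
      (f := fun a b => B j a * B i b), ← Finset.sum_sub_distrib]
    refine Finset.sum_congr rfl fun k hk => ?_
    rw [← Finset.sum_sub_distrib]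
    refine Finset.sum_eq_single_of_mem k hk fun l hl hlk => ?_
    rw [hB i k (hM k hk).2.symm, hB j l (hM l hl).1.symm,
      comm4 _ _ _ _ _ _ hij (hM l hl).2.symm (hM k hk).1 hlk.symm, sub_self]
  have hsum : B i j * (∑ m ∈ M, B j m) - (∑ m ∈ M, B j m) * B i j
      + (B i j * (∑ m ∈ M, B i m) - (∑ m ∈ M, B i m) * B i j)
      + ((∑ m ∈ M, B i m) * (∑ m ∈ M, B j m) - (∑ m ∈ M, B j m) * (∑ m ∈ M, B i m)) = 0 := by
    rw [hPQ, Finset.mul_sum, Finset.sum_mul, Finset.mul_sum, Finset.sum_mul,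
      ← Finset.sum_sub_distrib, ← Finset.sum_sub_distrib, ← Finset.sum_add_distrib,
      ← Finset.sum_add_distrib]
    refine Finset.sum_eq_zero fun m hm => ?_
    obtain ⟨hmj, hmi⟩ := hM m hm
    rw [hB i j hij, hB j m hmj.symm, hB i m hmi.symm]
    have e1 := three i j m hij hmj.symm hmi
    have e2 := three j i m hij.symm hmi.symm hmj
    rw [anti m i hmi] at e1
    rw [anti m j hmj, anti j i hij.symm] at e2
    have e3 := congrArg₂ (fun u v => u - v) e1 e2
    simp only [sub_zero] at e3
    rw [← e3]
    noncomm_ring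
  have sumx' : B i j * x i + B i j * x j - x i * B i j - x j * B i j = 0 := by
    rw [hB i j hij, ← mul_add, sumx]; noncomm_ring
  have hP' := sub_eq_zero.2 hP
  have hQ' := sub_eq_zero.2 hQ
  have xx' := sub_eq_zero.2 xx
  rw [commute_iff_eq, di, dj, ← sub_eq_zero]
  generalize (∑ m ∈ M, B i m) = P at *
  generalize (∑ m ∈ M, B j m) = Q at *
  generalize B i j = b at *
  calc _ = (x i * x j - x j * x i) + (b * x i + b * x j - x i * b - x j * b)
        + (P * x j - x j * P) - (Q * x i - x i * Q)
        + (b * Q - Q * b + (b * P - P * b) + (P * Q - Q * P)) := by noncomm_ring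
    _ = 0 := by rw [xx', sumx', hP', hQ', hsum]; simp

/-- The value `e_k(θ_1, …, θ_n)` of the elementary symmetric polynomial at the (pairwise
commuting) Dunkl elements. -/
noncomputable def esymmDunkl (n k : ℕ) : ExtAlg n :=
  ∑ s ∈ Finset.powersetCard k (Finset.univ : Finset (Fin n)),
    s.noncommProd dunkl (fun i _ j _ _ => dunkl_commute i j)

/-- The element `e_k(y_1, …, y_n)` of `Ẽ_n[t]`, for an integer `k`, with the convention that
it is zero for `k < 0`. -/
noncomputable def esymmY (n : ℕ) (k : ℤ) : ExtAlg n :=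
  if k < 0 then 0
  else algebraMap (YRing n) (ExtAlg n) (MvPolynomial.esymm (Fin n) ℤ k.toNat)

end ExtAlg

/-! The top case carries everything: the product of all `θ_i` equals the sum over partial matchings
of the index set, an edge weighing `-t` and an unmatched vertex `x_i`. This is proved by multiplying
the `θ_i` one at a time, keeping all their brackets. If the index set is `S ⊔ J`, the product over
`S` is a sum over `W ⊆ S`: the matching sum of `S \ W` times all ways of sending `W` to `J`, each
fibre over `j` contributing the words `[a₁,j]⋯[aᵣ,j]` in every order (`commProd_theta_eq_sum`). When
`J` is exhausted, only `W = ∅` survives.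

To pass `m` from `J` to `S`, multiply by `θ_m`. Its brackets split according to `W`. One part turns
`m` into a further letter sent to `J` (`wordList_cons_mul`). The other, together with `x_m`, absorbs
the words ending at `m` into the matching sum (`sum_matchSum_mul_word`). The bracket half rests on
the vanishing `word_mul_sum`, a many-letter form of `[i,m]² = 0`; the other half rests on `[i,m] x_m
= x_i [i,m] - t`, which creates the edges.

For general `k`, all relations of a bracket system survive `x_i ↦ x_i + X` with `X` central; the
relations `e_k(x) = e_k(y)` would not, so they are left out of the structure. The coefficient of
`X^(n-k)` in the top case gives `e_k(θ)`: a set of `k - p` unmatched vertices can be completed by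
`C(n-k+p, p)` sets of `p` matched ones, and `2r` vertices have `(2r-1)!!` perfect matchings. -/

/-- A system of brackets `[i,j]`, commuting variables `x_i` and an element `t` in a ring, subject
to the relations of the extended quadratic algebra. -/
structure BracketSystem (ι A : Type*) [Ring A] where
  br : ι → ι → A
  x : ι → A
  t : A
  br_self : ∀ i, br i i = 0
  br_antisymm : ∀ i j, br i j = -br j i
  br_mul_self : ∀ i j, br i j * br i j = 0
  br_commute : ∀ {i j k l}, i ≠ k → i ≠ l → j ≠ k → j ≠ l → Commute (br i j) (br k l)
  three_term : ∀ {i j k}, i ≠ j → j ≠ k → k ≠ i →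
    br i j * br j k + br j k * br k i + br k i * br i j = 0
  br_commute_x : ∀ {i j k}, k ≠ i → k ≠ j → Commute (br i j) (x k)
  br_mul_x : ∀ {i j}, i ≠ j → br i j * x j = x i * br i j - t
  br_commute_t : ∀ i j, Commute (br i j) t
  x_commute : ∀ i j, Commute (x i) (x j)
  x_commute_t : ∀ i, Commute (x i) t

/-! ### Reindexing sums over subsets. -/

section Sums

variable {ι M : Type*} [DecidableEq ι] [AddCommMonoid M]

theorem Finset.sum_sum_erase_comm (S : Finset ι) (f : ι → ι → M) :
    ∑ i ∈ S, ∑ k ∈ S.erase i, f i k = ∑ i ∈ S, ∑ k ∈ S.erase i, f k i :=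
  Finset.sum_comm' fun i k => by simp only [Finset.mem_erase]; tauto

theorem Finset.sum_powerset_sum_mem (S : Finset ι) (f : Finset ι → ι → M) :
    ∑ T ∈ S.powerset, ∑ i ∈ T, f T i
      = ∑ i ∈ S, ∑ T ∈ (S.erase i).powerset, f (insert i T) i := by
  rw [Finset.sum_sigma', Finset.sum_sigma']
  refine Finset.sum_bij' (fun p _ => ⟨p.2, p.1.erase p.2⟩) (fun p _ => ⟨insert p.1 p.2, p.1⟩)
    ?_ ?_ ?_ ?_ ?_
  · rintro ⟨T, i⟩ h
    simp only [Finset.mem_sigma, Finset.mem_powerset] at h ⊢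
    exact ⟨h.1 h.2, Finset.erase_subset_erase _ h.1⟩
  · rintro ⟨i, T⟩ h
    simp only [Finset.mem_sigma, Finset.mem_powerset] at h ⊢
    exact ⟨Finset.insert_subset h.1 (h.2.trans (Finset.erase_subset _ _)),
      Finset.mem_insert_self _ _⟩
  · rintro ⟨T, i⟩ h
    simp only [Finset.mem_sigma] at h
    simp [Finset.insert_erase h.2]
  · rintro ⟨i, T⟩ h
    simp only [Finset.mem_sigma, Finset.mem_powerset] at h
    have : i ∉ T := fun hi => by simpa using h.2 hi
    simp [Finset.erase_insert this]
  · rintro ⟨T, i⟩ h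
    simp only [Finset.mem_sigma] at h
    simp [Finset.insert_erase h.2]

theorem Finset.sum_powerset_sum_sdiff (S : Finset ι) (f : Finset ι → ι → M) :
    ∑ T ∈ S.powerset, ∑ i ∈ S \ T, f T i
      = ∑ i ∈ S, ∑ T ∈ (S.erase i).powerset, f T i :=
  Finset.sum_comm' fun T i => by
    simp only [Finset.mem_powerset, Finset.mem_sdiff, Finset.subset_erase]; tauto

theorem Finset.sum_powerset_sdiff (S : Finset ι) (f : Finset ι → Finset ι → M) :
    ∑ T ∈ S.powerset, f (S \ T) T = ∑ T ∈ S.powerset, f T (S \ T) := by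
  refine Finset.sum_bij' (fun T _ => S \ T) (fun T _ => S \ T) ?_ ?_ ?_ ?_ ?_
  all_goals intro T hT; rw [Finset.mem_powerset] at hT
  · simp
  · simp
  · simp [hT]
  · simp [hT]
  · simp [hT]

/-- Two ways of summing over the ordered partitions of `S` into three blocks. -/
theorem Finset.sum_powerset_sum_powerset (S : Finset ι)
    (f : Finset ι → Finset ι → Finset ι → M) :
    ∑ W ∈ S.powerset, ∑ T ∈ W.powerset, f (S \ W) (W \ T) T
      = ∑ V ∈ S.powerset, ∑ T ∈ (S \ V).powerset, f ((S \ V) \ T) V T := by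
  rw [Finset.sum_sigma', Finset.sum_sigma']
  refine Finset.sum_bij' (fun p _ => ⟨p.1 \ p.2, p.2⟩) (fun p _ => ⟨p.1 ∪ p.2, p.2⟩)
    ?_ ?_ ?_ ?_ ?_
  all_goals rintro ⟨T, U⟩ h
  all_goals simp only [Finset.mem_sigma, Finset.mem_powerset] at h ⊢
  · exact ⟨Finset.sdiff_subset.trans h.1, fun i hi => by
      simp [h.1 (h.2 hi), hi]⟩
  · exact ⟨Finset.union_subset h.1 (h.2.trans Finset.sdiff_subset), Finset.subset_union_right⟩
  · simp [Finset.sdiff_union_of_subset h.2]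
  · have : Disjoint T U := (Finset.disjoint_of_subset_left h.2 Finset.sdiff_disjoint).symm
    simp [Finset.union_sdiff_cancel_right this]
  · congr 1
    ext i
    have := @h.2 i
    have := @h.1 i
    simp only [Finset.mem_sdiff]
    tauto

end Sums

/-! ### Words of brackets with one or two common endpoints. -/

namespace BracketSystem

variable {ι A : Type*} [DecidableEq ι] [Ring A] (D : BracketSystem ι A)

omit [DecidableEq ι] in
/-- The relation among three brackets, solved for `[i,m][k,m]`. -/
theorem br_mul_br {i k m : ι} (hik : i ≠ k) (him : i ≠ m) (hkm : k ≠ m) :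
    D.br i m * D.br k m = D.br k i * D.br i m - D.br k m * D.br k i := by
  have h := D.three_term hik.symm him hkm.symm
  rw [D.br_antisymm m k] at h
  rw [← sub_eq_zero, ← neg_eq_zero, ← h]
  noncomm_ring

/-- Auxiliary to `word`, by recursion on the length. -/
def wordAux (m : ι) : ℕ → Finset ι → A
  | 0, _ => 1
  | n + 1, S => ∑ i ∈ S, wordAux m n (S.erase i) * D.br i m

/-- The sum of the products `[a₁,m]⋯[aᵣ,m]` over all orderings `a₁, …, aᵣ` of `S`. -/
def word (m : ι) (S : Finset ι) : A := D.wordAux m S.card S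

@[simp] theorem word_empty (m : ι) : D.word m ∅ = 1 := rfl

theorem word_of_nonempty (m : ι) {S : Finset ι} (hS : S.Nonempty) :
    D.word m S = ∑ i ∈ S, D.word m (S.erase i) * D.br i m := by
  obtain ⟨n, hn⟩ : ∃ n, S.card = n + 1 :=
    Nat.exists_eq_succ_of_ne_zero (Finset.card_ne_zero.2 hS)
  rw [word, hn, wordAux]
  refine Finset.sum_congr rfl fun i hi => ?_
  rw [word, Finset.card_erase_of_mem hi, hn, Nat.add_sub_cancel]

theorem word_eq (m : ι) (S : Finset ι) :
    D.word m S = (if S = ∅ then 1 else 0) + ∑ i ∈ S, D.word m (S.erase i) * D.br i m := by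
  rcases S.eq_empty_or_nonempty with rfl | hS
  · simp
  · rw [if_neg hS.ne_empty, zero_add, ← D.word_of_nonempty m hS]

theorem word_insert (m : ι) {S : Finset ι} {s : ι} (hs : s ∉ S) :
    D.word m (insert s S)
      = D.word m S * D.br s m + ∑ i ∈ S, D.word m (insert s (S.erase i)) * D.br i m := by
  rw [D.word_of_nonempty m (Finset.insert_nonempty s S), Finset.sum_insert hs,
    Finset.erase_insert hs]
  congr 1
  refine Finset.sum_congr rfl fun i hi => ?_
  rw [Finset.erase_insert_of_ne (ne_of_mem_of_not_mem hi hs).symm]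

theorem word_commute (m : ι) (a : A) (S : Finset ι) (h : ∀ i ∈ S, Commute (D.br i m) a) :
    Commute (D.word m S) a := by
  induction S using Finset.strongInduction with
  | H S ih =>
    rw [D.word_eq]
    refine Commute.add_left (by split_ifs <;> simp) (Commute.sum_left _ _ _ fun i hi => ?_)
    exact (ih _ (Finset.erase_ssubset hi) fun j hj => h j (Finset.mem_of_mem_erase hj)).mul_left
      (h i hi)

/-- Moves the letter indexed by `s` to the front, so that induction can apply to the word in `S`
behind it. By induction on the last letter: a final `[s,m]` is moved by the three-term relation, and
brackets with disjoint indices commute. -/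
theorem word_insert_left (m : ι) (S : Finset ι) (s : ι) (hs : s ∉ S) (hm : m ∉ S) (hsm : s ≠ m) :
    D.word m (insert s S) = (D.br s m + ∑ i ∈ S, D.br s i) * D.word m S
      - ∑ i ∈ S, D.word m (insert s (S.erase i)) * D.br s i := by
  induction S using Finset.strongInduction with
  | H S ih =>
    rcases S.eq_empty_or_nonempty with rfl | hS
    · rw [D.word_insert m hs]
      simp
    have hne : ∀ i ∈ S, s ≠ i := fun i hi => (ne_of_mem_of_not_mem hi hs).symm
    have hnm : ∀ i ∈ S, i ≠ m := fun i hi => ne_of_mem_of_not_mem hi hm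
    have comm : ∀ i ∈ S, D.br s i * D.word m (S.erase i) = D.word m (S.erase i) * D.br s i :=
      fun i hi => (D.word_commute m _ _ fun k hk => by
        obtain ⟨hki, hk⟩ := Finset.mem_erase.1 hk
        exact D.br_commute (hne k hk).symm hki hsm.symm (hnm i hi).symm).eq.symm
    have e1 : ∑ i ∈ S, D.word m (insert s (S.erase i)) * D.br i m
        = ∑ i ∈ S, ((D.br s m + ∑ k ∈ S, D.br s k) * (D.word m (S.erase i) * D.br i m)
          - D.word m (S.erase i) * D.br s i * D.br i m)
          - ∑ i ∈ S, ∑ k ∈ S.erase i,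
            D.word m (insert s ((S.erase i).erase k)) * D.br s k * D.br i m := by
      rw [← Finset.sum_sub_distrib]
      refine Finset.sum_congr rfl fun i hi => ?_
      rw [ih _ (Finset.erase_ssubset hi) (fun h => hs (Finset.mem_of_mem_erase h))
        (fun h => hm (Finset.mem_of_mem_erase h)), sub_mul, Finset.sum_mul, ← comm i hi,
        ← Finset.add_sum_erase S _ hi]
      congr 1
      noncomm_ring
    -- After exchanging the sums, `[s,k]` commutes past `[i,m]`, and the inner sum is the
    -- last-letter expansion of a word without its `[s,m]` term.
    have e2 : ∑ i ∈ S, ∑ k ∈ S.erase i,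
            D.word m (insert s ((S.erase i).erase k)) * D.br s k * D.br i m
        = ∑ k ∈ S, (D.word m (insert s (S.erase k)) * D.br s k
          - D.word m (S.erase k) * D.br s m * D.br s k) := by
      rw [Finset.sum_sum_erase_comm]
      refine Finset.sum_congr rfl fun k hk => ?_
      rw [D.word_insert m (fun h => hs (Finset.mem_of_mem_erase h) : s ∉ S.erase k), ← sub_mul,
        add_sub_cancel_left, Finset.sum_mul]
      refine Finset.sum_congr rfl fun i hi => ?_
      obtain ⟨hik, hi⟩ := Finset.mem_erase.1 hi
      rw [Finset.erase_right_comm, mul_assoc, mul_assoc,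
        (D.br_commute (hne i hi) hsm hik.symm (hnm k hk)).eq]
    have e3 : D.word m S * D.br s m = ∑ i ∈ S, (D.word m (S.erase i) * D.br s i * D.br i m
        - D.word m (S.erase i) * D.br s m * D.br s i) := by
      rw [D.word_of_nonempty m hS, Finset.sum_mul]
      refine Finset.sum_congr rfl fun i hi => ?_
      rw [mul_assoc, D.br_mul_br (hne i hi).symm (hnm i hi) hsm]
      noncomm_ring
    rw [D.word_insert m hs, e1, e2, e3, Finset.sum_sub_distrib, Finset.sum_sub_distrib,
      Finset.sum_sub_distrib, ← Finset.mul_sum, ← D.word_of_nonempty m hS]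
    abel

/-- With `s` moved to the front, induction kills everything except terms ending in `[s,m]`. Their
left factors add up to `word m S * [s,m]`, and `[s,m]² = 0` finishes. -/
theorem word_mul_sum (m : ι) (S : Finset ι) (hm : m ∉ S) :
    D.word m S * ∑ i ∈ S, D.br i m = 0 := by
  obtain ⟨n, hn⟩ : ∃ n, S.card = n := ⟨_, rfl⟩
  induction n generalizing S with
  | zero => simp [Finset.card_eq_zero.1 hn]
  | succ n ih =>
    obtain ⟨s, S, hs, rfl, hc⟩ := Finset.card_eq_succ.1 hn
    obtain ⟨hms, hm'⟩ := not_or.1 (Finset.mem_insert.not.1 hm)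
    have hsm := Ne.symm hms
    have hnm : ∀ i ∈ S, i ≠ m := fun i hi => ne_of_mem_of_not_mem hi hm'
    have key : ∀ i ∈ S, D.br s i * ∑ k ∈ insert s S, D.br k m
        = (∑ k ∈ insert s (S.erase i), D.br k m) * D.br s i
          + D.br s i * D.br s m + D.br i m * D.br s m := fun i hi => by
      have hsi : s ≠ i := (ne_of_mem_of_not_mem hi hs).symm
      rw [Finset.sum_insert hs, ← Finset.add_sum_erase S _ hi,
        Finset.sum_insert (fun h => hs (Finset.mem_of_mem_erase h)),
        D.br_mul_br hsi.symm (hnm i hi) hsm]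
      have : D.br s i * ∑ k ∈ S.erase i, D.br k m = (∑ k ∈ S.erase i, D.br k m) * D.br s i := by
        rw [Finset.mul_sum, Finset.sum_mul]
        refine Finset.sum_congr rfl fun k hk => ?_
        obtain ⟨hki, hk⟩ := Finset.mem_erase.1 hk
        exact (D.br_commute (ne_of_mem_of_not_mem hk hs).symm hsm hki.symm (hnm i hi)).eq
      rw [mul_add, mul_add, this]
      noncomm_ring
    have h0 : ∀ i ∈ S, D.word m (insert s (S.erase i)) * (D.br s i * ∑ k ∈ insert s S, D.br k m)
        = D.word m (insert s (S.erase i)) * D.br s i * D.br s m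
          + D.word m (insert s (S.erase i)) * D.br i m * D.br s m := fun i hi => by
      have hs' : s ∉ S.erase i := fun h => hs (Finset.mem_of_mem_erase h)
      rw [key i hi, mul_add, mul_add, ← mul_assoc, ih, zero_mul, zero_add, mul_assoc, mul_assoc]
      · simp only [Finset.mem_insert, Finset.mem_erase]; tauto
      · rw [Finset.card_insert_of_notMem hs', Finset.card_erase_add_one hi, hc]
    have e := D.word_insert_left m S s hs hm' hsm
    calc D.word m (insert s S) * ∑ i ∈ insert s S, D.br i m
        = (D.br s m + ∑ i ∈ S, D.br s i) * D.word m S * D.br s m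
          - ∑ i ∈ S, D.word m (insert s (S.erase i)) * (D.br s i * ∑ k ∈ insert s S, D.br k m) := by
          rw [e, sub_mul, Finset.sum_mul]
          congr 1
          · rw [Finset.sum_insert hs, mul_add, mul_assoc _ _ (∑ i ∈ S, _), ih S hm' hc]
            simp
          · simp only [mul_assoc]
      _ = ((D.br s m + ∑ i ∈ S, D.br s i) * D.word m S
          - ∑ i ∈ S, D.word m (insert s (S.erase i)) * D.br s i
          - ∑ i ∈ S, D.word m (insert s (S.erase i)) * D.br i m) * D.br s m := by
          rw [Finset.sum_congr rfl h0, Finset.sum_add_distrib, sub_mul, sub_mul, Finset.sum_mul,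
            Finset.sum_mul]
          abel
      _ = 0 := by
          rw [← e, D.word_insert m hs, add_sub_cancel_right, mul_assoc, D.br_mul_self, mul_zero]

/-- The sum of `f (S \ T)` times the words in `T`, over the subsets `T` of `S`. -/
def conv (f : Finset ι → A) (m : ι) (S : Finset ι) : A :=
  ∑ T ∈ S.powerset, f (S \ T) * D.word m T

theorem sum_mul_ite_empty (f : Finset ι → A) (S : Finset ι) :
    ∑ T ∈ S.powerset, f (S \ T) * (if T = ∅ then 1 else 0) = f S := by
  rw [Finset.sum_eq_single_of_mem ∅ (Finset.empty_mem_powerset S) (fun T _ h => by simp [h])]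
  simp

/-- Sorts the products by their last letter; the term `f S` comes from the empty word. -/
theorem conv_eq (f : Finset ι → A) (m : ι) (S : Finset ι) :
    D.conv f m S = f S + ∑ i ∈ S, D.conv f m (S.erase i) * D.br i m := by
  have h : D.conv f m S = ∑ T ∈ S.powerset, f (S \ T) * (if T = ∅ then 1 else 0)
      + ∑ T ∈ S.powerset, ∑ i ∈ T, f (S \ T) * (D.word m (T.erase i) * D.br i m) := by
    rw [conv, ← Finset.sum_add_distrib]
    refine Finset.sum_congr rfl fun T _ => ?_
    rw [D.word_eq m T, mul_add, Finset.mul_sum]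
  rw [h, sum_mul_ite_empty, Finset.sum_powerset_sum_mem]
  congr 1
  refine Finset.sum_congr rfl fun i _ => ?_
  rw [conv, Finset.sum_mul]
  refine Finset.sum_congr rfl fun T hT => ?_
  have hi : i ∉ T := fun h => by simpa using Finset.mem_powerset.1 hT h
  rw [Finset.erase_insert hi, ← mul_assoc, Finset.sdiff_insert, Finset.erase_sdiff_comm]

/-- Words at `j` and at `m` may be written in either order once summed over all splittings of `S`.
Both sides obey the same last-letter recursion, because `[k,m]` and `[i,j]` commute for four
distinct indices. -/
theorem conv_word_symm (j m : ι) (hjm : j ≠ m) (S : Finset ι) (hj : j ∉ S) (hm : m ∉ S) :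
    D.conv (D.word j) m S = D.conv (D.word m) j S := by
  induction S using Finset.strongInduction with
  | H S ih =>
    rcases S.eq_empty_or_nonempty with rfl | hS
    · simp [conv]
    have hj' : ∀ i, j ∉ S.erase i := fun i h => hj (Finset.mem_of_mem_erase h)
    have hm' : ∀ i, m ∉ S.erase i := fun i h => hm (Finset.mem_of_mem_erase h)
    have ih1 : ∀ i ∈ S, D.conv (D.word j) m (S.erase i) = D.conv (D.word m) j (S.erase i) :=
      fun i hi => ih _ (Finset.erase_ssubset hi) (hj' i) (hm' i)
    have ih2 : ∀ i ∈ S, ∀ k ∈ S.erase i, D.conv (D.word j) m ((S.erase i).erase k)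
        = D.conv (D.word m) j ((S.erase i).erase k) := fun i hi k hk =>
      ih _ ((Finset.erase_ssubset hk).trans (Finset.erase_ssubset hi))
        (fun h => hj' i (Finset.mem_of_mem_erase h)) (fun h => hm' i (Finset.mem_of_mem_erase h))
    have e1 : ∑ i ∈ S, D.conv (D.word m) j (S.erase i) * D.br i j
        - ∑ i ∈ S, D.word j (S.erase i) * D.br i j
        = ∑ i ∈ S, ∑ k ∈ S.erase i,
          D.conv (D.word m) j ((S.erase i).erase k) * D.br k m * D.br i j := by
      rw [← Finset.sum_sub_distrib]
      refine Finset.sum_congr rfl fun i hi => ?_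
      rw [← ih1 i hi, D.conv_eq, add_mul, add_sub_cancel_left, Finset.sum_mul]
      exact Finset.sum_congr rfl fun k hk => by rw [ih2 i hi k hk]
    have e2 : ∑ i ∈ S, D.conv (D.word m) j (S.erase i) * D.br i m
        - ∑ i ∈ S, D.word m (S.erase i) * D.br i m
        = ∑ i ∈ S, ∑ k ∈ S.erase i,
          D.conv (D.word m) j ((S.erase i).erase k) * D.br k j * D.br i m := by
      rw [← Finset.sum_sub_distrib]
      refine Finset.sum_congr rfl fun i hi => ?_
      rw [D.conv_eq, add_mul, add_sub_cancel_left, Finset.sum_mul]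
    have e3 : ∑ i ∈ S, ∑ k ∈ S.erase i,
          D.conv (D.word m) j ((S.erase i).erase k) * D.br k m * D.br i j
        = ∑ i ∈ S, ∑ k ∈ S.erase i,
          D.conv (D.word m) j ((S.erase i).erase k) * D.br k j * D.br i m := by
      rw [Finset.sum_sum_erase_comm]
      refine Finset.sum_congr rfl fun i hi => Finset.sum_congr rfl fun k hk => ?_
      obtain ⟨hki, hk⟩ := Finset.mem_erase.1 hk
      rw [Finset.erase_right_comm, mul_assoc, mul_assoc,
        (D.br_commute hki.symm (ne_of_mem_of_not_mem hi hj)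
          (ne_of_mem_of_not_mem hk hm).symm hjm.symm).eq]
    rw [D.conv_eq (D.word j), D.conv_eq (D.word m), Finset.sum_congr rfl fun i hi => by rw [ih1 i hi],
      D.word_of_nonempty j hS, D.word_of_nonempty m hS]
    have e := e1.trans (e3.trans e2.symm)
    rw [sub_eq_sub_iff_add_eq_add] at e
    rw [add_comm, ← sub_eq_zero] at e
    rw [← sub_eq_zero, ← neg_eq_zero, ← e]
    abel

/-- The letters at `m` are traded for `m` itself becoming a letter at `j`. The three-term relation
rewrites `[i,m][m,j]` as `[m,j][i,j] + [i,j][i,m]`; the last terms cancel against the subtracted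
sum. -/
theorem conv_word_mul (j m : ι) (hjm : j ≠ m) (S : Finset ι) (hj : j ∉ S) (hm : m ∉ S) :
    D.conv (D.word j) m S * (D.br m j - ∑ i ∈ S, D.br i m) = D.word j (insert m S) := by
  induction S using Finset.strongInduction with
  | H S ih =>
    have e1 : D.conv (D.word j) m S * D.br m j = D.word j S * D.br m j
        + ∑ i ∈ S, D.conv (D.word j) m (S.erase i)
          * (D.br m j * D.br i j + D.br i j * D.br i m) := by
      rw [D.conv_eq, add_mul, Finset.sum_mul]
      congr 1
      refine Finset.sum_congr rfl fun i hi => ?_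
      have := D.three_term (ne_of_mem_of_not_mem hi hm) hjm.symm (ne_of_mem_of_not_mem hi hj).symm
      rw [D.br_antisymm j i] at this
      rw [mul_assoc, ← sub_eq_zero, ← mul_sub]
      convert mul_zero _
      rw [← this]
      noncomm_ring
    have e2 : D.conv (D.word j) m S * ∑ i ∈ S, D.br i m
        = ∑ i ∈ S, D.conv (D.word j) m (S.erase i)
          * (D.br i j * D.br i m + (∑ k ∈ S.erase i, D.br k m) * D.br i j) := by
      -- Putting the words at `m` first leaves one term without a letter at `j`, which
      -- `word_mul_sum` annihilates.
      rw [D.conv_word_symm j m hjm S hj hm, D.conv_eq, add_mul, D.word_mul_sum m S hm, zero_add,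
        Finset.sum_mul]
      refine Finset.sum_congr rfl fun i hi => ?_
      rw [D.conv_word_symm j m hjm _ (fun h => hj (Finset.mem_of_mem_erase h))
        (fun h => hm (Finset.mem_of_mem_erase h)), mul_assoc, ← Finset.add_sum_erase S _ hi, mul_add,
        Finset.mul_sum, Finset.sum_mul]
      congr 2
      refine Finset.sum_congr rfl fun k hk => ?_
      obtain ⟨hki, hk⟩ := Finset.mem_erase.1 hk
      exact (D.br_commute hki.symm (ne_of_mem_of_not_mem hi hm)
        (ne_of_mem_of_not_mem hk hj).symm hjm).eq
    rw [mul_sub, e1, e2, D.word_insert j hm, add_sub_assoc, ← Finset.sum_sub_distrib]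
    congr 1
    refine Finset.sum_congr rfl fun i hi => ?_
    rw [← ih _ (Finset.erase_ssubset hi) (fun h => hj (Finset.mem_of_mem_erase h))
        (fun h => hm (Finset.mem_of_mem_erase h))]
    noncomm_ring

end BracketSystem

/-! ### Products of commuting families. -/

section CommProd

variable {ι A : Type*} [Ring A]

/-- The product over `S` of a family of pairwise commuting elements. -/
def commProd (f : ι → A) (hf : ∀ i j, Commute (f i) (f j)) (S : Finset ι) : A :=
  S.noncommProd f fun i _ j _ _ => hf i j

theorem commProd_empty (f : ι → A) (hf : ∀ i j, Commute (f i) (f j)) : commProd f hf ∅ = 1 :=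
  Finset.noncommProd_empty _ _

theorem commProd_insert [DecidableEq ι] (f : ι → A) (hf : ∀ i j, Commute (f i) (f j)) {m : ι}
    {S : Finset ι} (hm : m ∉ S) : commProd f hf (insert m S) = f m * commProd f hf S :=
  Finset.noncommProd_insert_of_notMem _ _ _ _ hm

theorem commProd_insert' [DecidableEq ι] (f : ι → A) (hf : ∀ i j, Commute (f i) (f j)) {m : ι}
    {S : Finset ι} (hm : m ∉ S) : commProd f hf (insert m S) = commProd f hf S * f m :=
  Finset.noncommProd_insert_of_notMem' _ _ _ _ hm

theorem commProd_commute (f : ι → A) (hf : ∀ i j, Commute (f i) (f j)) (S : Finset ι) (a : A)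
    (h : ∀ i ∈ S, Commute (f i) a) : Commute (commProd f hf S) a :=
  (Finset.noncommProd_commute _ _ _ _ fun i hi => (h i hi).symm).symm

end CommProd

/-! ### Words distributed over a list of endpoints. -/

namespace BracketSystem

variable {ι A : Type*} [DecidableEq ι] [Ring A] (D : BracketSystem ι A)

theorem conv_conv (f : Finset ι → A) (j m : ι) (S : Finset ι) :
    D.conv (D.conv f j) m S = ∑ W ∈ S.powerset, f (S \ W) * D.conv (D.word j) m W := by
  have h := Finset.sum_powerset_sum_powerset S
    (fun a b c => f a * D.word j c * D.word m b)
  calc _ = _ := by simp only [conv, Finset.sum_mul]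
    _ = _ := h.symm
    _ = _ := by
      refine Finset.sum_congr rfl fun W _ => ?_
      rw [conv, Finset.sum_powerset_sdiff W (fun a b => D.word j a * D.word m b), Finset.mul_sum]
      simp only [mul_assoc]

theorem word_mul_sub_sum_sdiff (m : ι) {S T : Finset ι} (hT : T ⊆ S) (hm : m ∉ S) (c : A) :
    D.word m T * (c - ∑ i ∈ S \ T, D.br i m) = D.word m T * (c - ∑ i ∈ S, D.br i m) := by
  rw [← Finset.sum_sdiff hT, mul_sub, mul_sub, mul_add,
    D.word_mul_sum m T (fun h => hm (hT h)), add_zero]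

/-- The sum over all maps from `S` to the list `J` of the products of the words in the fibres;
the fibre over the head of the list stands last. -/
def wordList : List ι → Finset ι → A
  | [], S => if S = ∅ then 1 else 0
  | m :: J, S => D.conv (wordList J) m S

theorem wordList_empty (J : List ι) : D.wordList J ∅ = 1 := by
  induction J with
  | nil => simp [wordList]
  | cons m J ih => simp [wordList, conv, ih]

theorem wordList_commute (J : List ι) (a : A) (S : Finset ι)
    (h : ∀ j ∈ J, ∀ i ∈ S, Commute (D.br i j) a) : Commute (D.wordList J S) a := by
  induction J generalizing S with
  | nil => rw [wordList]; split_ifs <;> simp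
  | cons m J ih =>
    refine Commute.sum_left _ _ _ fun T hT => ?_
    rw [Finset.mem_powerset] at hT
    exact (ih _ fun j hj i hi => h j (by simp [hj]) i (Finset.sdiff_subset hi)).mul_left
      (D.word_commute m a T fun i hi => h m (by simp) i (hT hi))

/-- The bracket half of multiplication by `θ_m`. By induction on the list, `m` is sent either to the
head `j`, through `conv_word_mul`, or further down, through the induction hypothesis. For the empty
list both sides vanish, by `word_mul_sum`. -/
theorem wordList_cons_mul (J : List ι) (m : ι) (S : Finset ι) (hJ : J.Nodup) (hmJ : m ∉ J)
    (hm : m ∉ S) (hS : ∀ j ∈ J, j ∉ S) :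
    D.wordList (m :: J) S * ((J.map (D.br m)).sum - ∑ i ∈ S, D.br i m)
      = D.wordList J (insert m S) := by
  induction J generalizing S with
  | nil =>
    have h : D.wordList [m] S = D.word m S := by
      rw [wordList, conv, Finset.sum_powerset_sdiff S (fun a b => D.wordList [] a * D.word m b),
        Finset.sum_eq_single_of_mem ∅ (Finset.empty_mem_powerset S)
          (fun T _ h => by simp [wordList, h])]
      simp [wordList]
    rw [h, List.map_nil, List.sum_nil, mul_sub, D.word_mul_sum m S hm, wordList,
      if_neg (Finset.insert_ne_empty m S)]
    simp
  | cons j J ih =>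
    obtain ⟨hjJ, hJ⟩ := List.nodup_cons.1 hJ
    obtain ⟨hmj, hmJ⟩ := not_or.1 (List.mem_cons.not.1 hmJ)
    have hjm : j ≠ m := Ne.symm hmj
    have hj : j ∉ S := hS j (by simp)
    have hS : ∀ k ∈ J, k ∉ S := fun k hk => hS k (by simp [hk])
    set c : A := (J.map (D.br m)).sum with hc
    have split : D.wordList (m :: j :: J) S * ((List.map (D.br m) (j :: J)).sum
          - ∑ i ∈ S, D.br i m)
        = ∑ W ∈ S.powerset, D.wordList J (S \ W)
            * (D.conv (D.word j) m W * (D.br m j - ∑ i ∈ W, D.br i m))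
          + ∑ W ∈ S.powerset, D.wordList J (S \ W) * D.conv (D.word j) m W
            * (c - ∑ i ∈ S \ W, D.br i m) := by
      rw [wordList, show D.wordList (j :: J) = D.conv (D.wordList J) j from funext fun _ => rfl,
        conv_conv, Finset.sum_mul, ← Finset.sum_add_distrib]
      refine Finset.sum_congr rfl fun W hW => ?_
      rw [List.map_cons, List.sum_cons, ← Finset.sum_sdiff (Finset.mem_powerset.1 hW), ← hc]
      noncomm_ring
    have first : ∑ W ∈ S.powerset, D.wordList J (S \ W)
            * (D.conv (D.word j) m W * (D.br m j - ∑ i ∈ W, D.br i m))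
        = ∑ W ∈ S.powerset, D.wordList J (S \ W) * D.word j (insert m W) :=
      Finset.sum_congr rfl fun W hW => by
        rw [Finset.mem_powerset] at hW
        rw [D.conv_word_mul j m hjm W (fun h => hj (hW h)) (fun h => hm (hW h))]
    have comm : ∀ V ⊆ S, ∀ U ⊆ S \ V, D.word j V * (c - ∑ i ∈ U, D.br i m)
        = (c - ∑ i ∈ U, D.br i m) * D.word j V := fun V hV U hU => by
      refine D.word_commute j _ V fun i hi => Commute.sub_right ?_
        (Commute.sum_right _ _ _ fun k hk => ?_)
      · refine Commute.list_sum_right _ _ fun b hb => ?_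
        obtain ⟨k, hk, rfl⟩ := List.mem_map.1 hb
        exact D.br_commute (ne_of_mem_of_not_mem (hV hi) hm)
          (ne_of_mem_of_not_mem (hV hi) (hS k hk)) hjm (ne_of_mem_of_not_mem hk hjJ).symm
      · obtain ⟨hkS, hkV⟩ := Finset.mem_sdiff.1 (hU hk)
        exact D.br_commute (ne_of_mem_of_not_mem hi hkV) (ne_of_mem_of_not_mem (hV hi) hm)
          (ne_of_mem_of_not_mem hkS hj).symm hjm
    -- The words at `j` go to the right of those at `m` and past the bracket factor, with which they
    -- commute. Then `word_mul_sum` lets the subtracted sum run over all of `S \ V`, as the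
    -- induction hypothesis requires.
    have second : ∑ W ∈ S.powerset, D.wordList J (S \ W) * D.conv (D.word j) m W
            * (c - ∑ i ∈ S \ W, D.br i m)
        = ∑ V ∈ S.powerset, D.wordList J (insert m (S \ V)) * D.word j V := by
      have h := Finset.sum_powerset_sum_powerset S (fun a b d =>
        D.wordList J a * D.word m d * D.word j b * (c - ∑ i ∈ a, D.br i m))
      calc _ = _ := by
            refine Finset.sum_congr rfl fun W hW => ?_
            rw [Finset.mem_powerset] at hW
            rw [D.conv_word_symm j m hjm W (fun h => hj (hW h)) (fun h => hm (hW h)), conv,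
              Finset.sum_powerset_sdiff W (fun a b => D.word m a * D.word j b), Finset.mul_sum,
              Finset.sum_mul]
            simp only [← mul_assoc]
        _ = _ := h
        _ = _ := by
            refine Finset.sum_congr rfl fun V hV => ?_
            rw [Finset.mem_powerset] at hV
            have hmV : m ∉ S \ V := fun h => hm (Finset.sdiff_subset h)
            rw [← ih (S \ V) hJ hmJ hmV (fun k hk h => hS k hk (Finset.sdiff_subset h)), wordList,
              conv, Finset.sum_mul, Finset.sum_mul]
            refine Finset.sum_congr rfl fun T hT => ?_
            rw [mul_assoc _ (D.word j V), comm V hV _ Finset.sdiff_subset, ← mul_assoc,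
              mul_assoc (D.wordList J _),
              D.word_mul_sub_sum_sdiff m (Finset.mem_powerset.1 hT) hmV, ← mul_assoc]
    rw [split, first, second, wordList, conv, Finset.sum_powerset_insert hm, add_comm]
    congr 1
    all_goals refine Finset.sum_congr rfl fun T hT => ?_
    all_goals have hmT : m ∉ T := fun h => hm (Finset.mem_powerset.1 hT h)
    · rw [Finset.insert_sdiff_of_notMem _ hmT]
    · rw [Finset.insert_sdiff_insert, Finset.sdiff_insert_of_notMem hm]

/-! ### Matching sums and their interaction with words. -/

/-- The sum of `(-t) ^ r` over the perfect matchings, with `r` edges each, of a set of size `p`. -/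
def matchWeight : ℕ → A
  | 0 => 1
  | 1 => 0
  | p + 2 => (p + 1) • (-D.t * matchWeight p)

/-- The sum over the partial matchings of `S` of `-t` for each edge times the product of the `x_i`
over the unmatched vertices. -/
def matchSum (S : Finset ι) : A :=
  ∑ T ∈ S.powerset, D.matchWeight T.card * commProd D.x D.x_commute (S \ T)

omit [DecidableEq ι] in
theorem matchWeight_commute (a : A) (h : Commute D.t a) (p : ℕ) :
    Commute (D.matchWeight p) a := by
  induction p using Nat.twoStepInduction with
  | zero => simp [matchWeight]
  | one => simp [matchWeight]
  | more p ih _ => exact (h.neg_left.mul_left ih).smul_left _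

theorem matchSum_commute (S : Finset ι) (a : A) (ht : Commute D.t a)
    (h : ∀ i ∈ S, Commute (D.x i) a) : Commute (D.matchSum S) a :=
  Commute.sum_left _ _ _ fun _ _ => (D.matchWeight_commute a ht _).mul_left
    (commProd_commute D.x D.x_commute _ a fun i hi => h i (Finset.sdiff_subset hi))

theorem matchWeight_card_add_one (S : Finset ι) :
    D.matchWeight (S.card + 1) = -D.t * ∑ i ∈ S, D.matchWeight (S.erase i).card := by
  rw [Finset.sum_congr rfl fun i hi => by rw [Finset.card_erase_of_mem hi], Finset.sum_const]
  rcases h : S.card with _ | p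
  · simp [matchWeight]
  · rw [matchWeight, Nat.add_sub_cancel, mul_smul_comm]

theorem matchSum_empty : D.matchSum ∅ = 1 := by
  simp [matchSum, matchWeight, commProd_empty]

/-- The vertex `m` is either unmatched or joined to some `i ∈ S`. -/
theorem matchSum_insert {m : ι} {S : Finset ι} (hm : m ∉ S) :
    D.matchSum (insert m S) = D.x m * D.matchSum S - D.t * ∑ i ∈ S, D.matchSum (S.erase i) := by
  rw [matchSum, Finset.sum_powerset_insert hm, sub_eq_add_neg, ← neg_mul]
  congr 1
  · rw [matchSum, Finset.mul_sum]
    refine Finset.sum_congr rfl fun T hT => ?_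
    have hmT : m ∉ T := fun h => hm (Finset.mem_powerset.1 hT h)
    rw [Finset.insert_sdiff_of_notMem _ hmT,
      commProd_insert D.x D.x_commute (fun h => hm (Finset.sdiff_subset h)), ← mul_assoc, ← mul_assoc,
      (D.matchWeight_commute _ (D.x_commute_t m).symm _).eq]
  · have h := Finset.sum_powerset_sum_mem S
      (fun T i => D.matchWeight (T.erase i).card * commProd D.x D.x_commute (S \ T))
    calc _ = -D.t * ∑ T ∈ S.powerset, ∑ i ∈ T,
          D.matchWeight (T.erase i).card * commProd D.x D.x_commute (S \ T) := by
          rw [Finset.mul_sum]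
          refine Finset.sum_congr rfl fun T hT => ?_
          have hmT : m ∉ T := fun h => hm (Finset.mem_powerset.1 hT h)
          rw [Finset.card_insert_of_notMem hmT, D.matchWeight_card_add_one,
            Finset.insert_sdiff_insert, Finset.sdiff_insert_of_notMem hm, mul_assoc, Finset.sum_mul]
      _ = _ := by
          rw [h]
          congr 1
          refine Finset.sum_congr rfl fun i _ => Finset.sum_congr rfl fun T hT => ?_
          have hi : i ∉ T := fun h => by simpa using Finset.mem_powerset.1 hT h
          rw [Finset.erase_insert hi, Finset.sdiff_insert, Finset.erase_sdiff_comm]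

/-- Moving `x_m` left across the last letter `[i,m]` yields `x_i` and `-t`. The `x_i` terms cancel
against those from expanding the matching sum at `i` in the subtracted brackets. Of the `t` terms
only the empty words remain, giving the recursion of `matchSum_insert`. -/
theorem sum_matchSum_mul_word (m : ι) (S : Finset ι) (hm : m ∉ S) :
    ∑ T ∈ S.powerset, D.matchSum (S \ T) * D.word m T * (D.x m - ∑ i ∈ S \ T, D.br i m)
      = D.matchSum (insert m S) := by
  have e1 : ∀ T ∈ S.powerset, D.matchSum (S \ T) * D.word m T * D.x m
      = D.matchSum (S \ T) * (if T = ∅ then 1 else 0) * D.x m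
        + ∑ i ∈ T, (D.x i * (D.matchSum (S \ T) * D.word m (T.erase i)) * D.br i m
          - D.t * (D.matchSum (S \ T) * D.word m (T.erase i))) := fun T hT => by
    rw [Finset.mem_powerset] at hT
    rw [D.word_eq m T, mul_add, add_mul]
    congr 1
    rw [Finset.mul_sum, Finset.sum_mul]
    refine Finset.sum_congr rfl fun i hi => ?_
    have him : i ≠ m := ne_of_mem_of_not_mem (hT hi) hm
    have c1 : Commute (D.matchSum (S \ T) * D.word m (T.erase i)) (D.x i) :=
      (D.matchSum_commute _ _ (D.x_commute_t i).symm fun k _ => D.x_commute k i).mul_left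
        (D.word_commute m _ _ fun k hk =>
          D.br_commute_x (ne_of_mem_of_not_mem hk (by simp)).symm him)
    have c2 : Commute (D.matchSum (S \ T) * D.word m (T.erase i)) D.t :=
      (D.matchSum_commute _ _ (Commute.refl _) fun k _ => D.x_commute_t k).mul_left
        (D.word_commute m _ _ fun k _ => D.br_commute_t k m)
    rw [← c1.eq, ← c2.eq, mul_assoc, mul_assoc (D.word _ _), D.br_mul_x him]
    noncomm_ring
  have e2 : ∀ T ∈ S.powerset, D.matchSum (S \ T) * D.word m T * (∑ i ∈ S \ T, D.br i m)
      = ∑ i ∈ S \ T, (D.x i * (D.matchSum ((S.erase i) \ T) * D.word m T) * D.br i m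
        - D.t * ∑ k ∈ (S.erase i) \ T,
          D.matchSum (((S.erase i).erase k) \ T) * D.word m T * D.br i m) := fun T hT => by
    rw [Finset.mul_sum]
    refine Finset.sum_congr rfl fun i hi => ?_
    have h : S \ T = insert i ((S.erase i) \ T) := by
      rw [Finset.erase_sdiff_comm, Finset.insert_erase hi]
    rw [h, D.matchSum_insert (by simp), sub_mul, sub_mul, ← mul_assoc, mul_assoc D.t, mul_assoc D.t,
      Finset.sum_mul, Finset.sum_mul]
    simp only [Finset.erase_sdiff_comm]
  have e3 : ∑ T ∈ S.powerset, D.matchSum (S \ T) * D.word m T * (∑ i ∈ S \ T, D.br i m)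
      = ∑ i ∈ S, D.x i * D.conv D.matchSum m (S.erase i) * D.br i m
        - D.t * ∑ i ∈ S, (D.conv D.matchSum m (S.erase i) - D.matchSum (S.erase i)) := by
    rw [Finset.sum_congr rfl e2, Finset.sum_powerset_sum_sdiff]
    have h : ∀ i ∈ S, D.conv D.matchSum m (S.erase i) - D.matchSum (S.erase i)
        = ∑ k ∈ S.erase i, D.conv D.matchSum m ((S.erase i).erase k) * D.br k m := fun i _ => by
      rw [D.conv_eq, add_sub_cancel_left]
    rw [Finset.sum_congr rfl h, Finset.sum_sum_erase_comm, Finset.mul_sum,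
      ← Finset.sum_sub_distrib]
    refine Finset.sum_congr rfl fun i _ => ?_
    rw [Finset.sum_sub_distrib, ← Finset.mul_sum, Finset.sum_powerset_sum_sdiff, conv,
      Finset.mul_sum (S.erase i).powerset, Finset.sum_mul]
    congr 2
    refine Finset.sum_congr rfl fun k _ => ?_
    rw [Finset.erase_right_comm, conv, Finset.sum_mul]
  have e4 : ∑ T ∈ S.powerset, D.matchSum (S \ T) * D.word m T * D.x m
      = D.matchSum S * D.x m
        + (∑ i ∈ S, D.x i * D.conv D.matchSum m (S.erase i) * D.br i m
          - D.t * ∑ i ∈ S, D.conv D.matchSum m (S.erase i)) := by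
    rw [Finset.sum_congr rfl e1, Finset.sum_add_distrib, ← Finset.sum_mul, sum_mul_ite_empty,
      Finset.sum_powerset_sum_mem, Finset.mul_sum, ← Finset.sum_sub_distrib]
    congr 1
    refine Finset.sum_congr rfl fun i _ => ?_
    rw [conv, Finset.mul_sum, Finset.mul_sum, Finset.sum_mul, ← Finset.sum_sub_distrib]
    refine Finset.sum_congr rfl fun T hT => ?_
    have hi : i ∉ T := fun h => by simpa using Finset.mem_powerset.1 hT h
    rw [Finset.erase_insert hi, Finset.sdiff_insert, Finset.erase_sdiff_comm]
  simp only [mul_sub, Finset.sum_sub_distrib] at e3 e4 ⊢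
  rw [e3, e4, D.matchSum_insert hm,
    (D.matchSum_commute S (D.x m) (D.x_commute_t m).symm fun k _ => D.x_commute k m).eq]
  abel

/-- The second factor is `θ_m` with partners in `S` and `J`. For each `W`, its brackets with `J` and
`W` make `m` a letter; `x_m` and the brackets with `S \ W` put `m` into the matching sum. -/
theorem sum_matchSum_mul_wordList_cons (J : List ι) (m : ι) (S : Finset ι) (hJ : J.Nodup)
    (hmJ : m ∉ J) (hm : m ∉ S) (hS : ∀ j ∈ J, j ∉ S) :
    (∑ W ∈ S.powerset, D.matchSum (S \ W) * D.wordList (m :: J) W)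
        * (D.x m + ((J.map (D.br m)).sum - ∑ i ∈ S, D.br i m))
      = ∑ W ∈ (insert m S).powerset, D.matchSum (insert m S \ W) * D.wordList J W := by
  have comm : ∀ V ⊆ S, ∀ U ⊆ insert m S, Disjoint U V →
      D.wordList J V * D.matchSum U = D.matchSum U * D.wordList J V := fun V hV U hU hUV =>
    D.wordList_commute J _ V fun j hj i hi => (D.matchSum_commute U _ (D.br_commute_t i j).symm
      fun k hk => (D.br_commute_x (ne_of_mem_of_not_mem hi (Finset.disjoint_left.1 hUV hk)).symm
        (by
          rintro rfl
          rcases Finset.mem_insert.1 (hU hk) with rfl | h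
          · exact hmJ hj
          · exact hS _ hj h)).symm).symm
  have split : (∑ W ∈ S.powerset, D.matchSum (S \ W) * D.wordList (m :: J) W)
        * (D.x m + ((J.map (D.br m)).sum - ∑ i ∈ S, D.br i m))
      = ∑ W ∈ S.powerset, D.matchSum (S \ W) * D.wordList (m :: J) W
          * (D.x m - ∑ i ∈ S \ W, D.br i m)
        + ∑ W ∈ S.powerset, D.matchSum (S \ W) * D.wordList J (insert m W) := by
    rw [Finset.sum_mul, ← Finset.sum_add_distrib]
    refine Finset.sum_congr rfl fun W hW => ?_
    rw [Finset.mem_powerset] at hW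
    rw [← D.wordList_cons_mul J m W hJ hmJ (fun h => hm (hW h)) (fun j hj h => hS j hj (hW h)),
      ← Finset.sum_sdiff hW]
    noncomm_ring
  have first : ∑ W ∈ S.powerset, D.matchSum (S \ W) * D.wordList (m :: J) W
          * (D.x m - ∑ i ∈ S \ W, D.br i m)
      = ∑ V ∈ S.powerset, D.matchSum (insert m (S \ V)) * D.wordList J V := by
    have h := Finset.sum_powerset_sum_powerset S (fun a b d =>
      D.matchSum a * D.wordList J b * D.word m d * (D.x m - ∑ i ∈ a, D.br i m))
    calc _ = _ := by
          refine Finset.sum_congr rfl fun W _ => ?_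
          rw [wordList, conv, Finset.mul_sum, Finset.sum_mul]
          simp only [← mul_assoc]
      _ = _ := h
      _ = _ := by
          refine Finset.sum_congr rfl fun V hV => ?_
          rw [Finset.mem_powerset] at hV
          have hmV : m ∉ V := fun h => hm (hV h)
          rw [← comm V hV _ (Finset.insert_subset_insert m Finset.sdiff_subset)
            (Finset.disjoint_insert_left.2 ⟨hmV, Finset.sdiff_disjoint⟩),
            ← D.sum_matchSum_mul_word m _ (fun h => hm (Finset.sdiff_subset h)), Finset.mul_sum]
          refine Finset.sum_congr rfl fun T _ => ?_
          rw [← comm V hV _ ((Finset.sdiff_subset.trans Finset.sdiff_subset).trans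
            (Finset.subset_insert m S)) (Finset.disjoint_of_subset_left Finset.sdiff_subset
              Finset.sdiff_disjoint)]
          simp only [mul_assoc]
  rw [split, first, Finset.sum_powerset_insert hm]
  congr 1
  all_goals refine Finset.sum_congr rfl fun T hT => ?_
  all_goals have hmT : m ∉ T := fun h => hm (Finset.mem_powerset.1 hT h)
  · rw [Finset.insert_sdiff_of_notMem _ hmT]
  · rw [Finset.insert_sdiff_insert, Finset.sdiff_insert_of_notMem hm]

/-! ### The product of all Dunkl elements. -/

/-- The Dunkl element with brackets restricted to partners in `K`. -/
def theta (K : Finset ι) (i : ι) : A := D.x i + ∑ j ∈ K, D.br i j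

/-- `K` stays fixed while `S` grows, so the induction must range over all lists `J`: the step for
`insert m S` and `J` uses the hypothesis for `S` and `m :: J`. -/
theorem commProd_theta_eq_sum (K : Finset ι)
    (hK : ∀ i j, Commute (D.theta K i) (D.theta K j)) (S : Finset ι) (J : List ι) (hJ : J.Nodup)
    (hS : ∀ j ∈ J, j ∉ S) (hKS : K = S ∪ J.toFinset) :
    commProd (D.theta K) hK S
      = ∑ W ∈ S.powerset, D.matchSum (S \ W) * D.wordList J W := by
  induction S using Finset.induction_on generalizing J with
  | empty => simp [matchSum_empty, wordList_empty, commProd_empty]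
  | insert m S hm ih =>
    have hmJ : m ∉ J := fun h => hS m h (Finset.mem_insert_self m S)
    have hS' : ∀ j ∈ J, j ∉ S := fun j hj h => hS j hj (Finset.mem_insert_of_mem h)
    rw [commProd_insert' _ _ hm,
      ih (m :: J) (List.nodup_cons.2 ⟨hmJ, hJ⟩) (by simpa [hm] using hS')
        (by rw [hKS]; ext; simp only [Finset.mem_union, Finset.mem_insert, List.toFinset_cons]; tauto),
      ← D.sum_matchSum_mul_wordList_cons J m S hJ hmJ hm hS']
    congr 1
    have hd : Disjoint S J.toFinset := Finset.disjoint_left.2 fun i hi hiJ =>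
      hS' i (List.mem_toFinset.1 hiJ) hi
    rw [theta, hKS, Finset.insert_union, Finset.sum_insert (by simp [hm, hmJ]), D.br_self, zero_add,
      Finset.sum_union hd, List.sum_toFinset _ hJ, sub_eq_add_neg, ← Finset.sum_neg_distrib,
      Finset.sum_congr rfl fun i _ => D.br_antisymm m i]
    abel

theorem commProd_theta (K : Finset ι) (hK : ∀ i j, Commute (D.theta K i) (D.theta K j)) :
    commProd (D.theta K) hK K = D.matchSum K := by
  rw [D.commProd_theta_eq_sum K hK K [] List.nodup_nil (by simp) (by simp),
    Finset.sum_eq_single_of_mem ∅ (Finset.empty_mem_powerset K)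
      (fun T _ h => by simp [wordList, h])]
  simp [wordList]

end BracketSystem

/-! ### From the full product to all elementary symmetric functions. -/

theorem commProd_eq_prod_map {ι A : Type*} [DecidableEq ι] [Ring A] (f : ι → A)
    (hf : ∀ i j, Commute (f i) (f j)) {l : List ι} {S : Finset ι} (hl : l.Nodup)
    (hS : l.toFinset = S) : commProd f hf S = (l.map f).prod := by
  subst hS
  exact Finset.noncommProd_toFinset _ _ _ hl

open Polynomial in
theorem commProd_C_add_X {ι A : Type*} [DecidableEq ι] [Ring A] (f : ι → A)
    (hf : ∀ i j, Commute (f i) (f j)) (hg : ∀ i j, Commute (C (f i) + X) (C (f j) + X))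
    (S : Finset ι) :
    commProd (fun i => C (f i) + X) hg S
      = ∑ T ∈ S.powerset, C (commProd f hf T) * X ^ (S \ T).card := by
  induction S using Finset.induction_on with
  | empty => simp [commProd_empty]
  | insert m S hm ih =>
    rw [commProd_insert _ _ hm, ih, Finset.sum_powerset_insert hm, add_mul, add_comm,
      Finset.mul_sum, Finset.mul_sum]
    congr 1
    all_goals refine Finset.sum_congr rfl fun T hT => ?_
    all_goals have hmT : m ∉ T := fun h => hm (Finset.mem_powerset.1 hT h)
    · rw [Finset.insert_sdiff_of_notMem _ hmT,
        Finset.card_insert_of_notMem (fun h => hm (Finset.sdiff_subset h)), ← mul_assoc, X_mul,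
        mul_assoc, pow_succ']
    · rw [Finset.insert_sdiff_insert, Finset.sdiff_insert_of_notMem hm, commProd_insert _ _ hmT,
        C_mul, mul_assoc]

namespace BracketSystem

variable {ι A : Type*} [DecidableEq ι] [Ring A] (D : BracketSystem ι A)

open Polynomial in
omit [DecidableEq ι] in
/-- Adding a central indeterminate to all the `x_i`. -/
noncomputable def shift : BracketSystem ι A[X] where
  br i j := C (D.br i j)
  x i := C (D.x i) + X
  t := C D.t
  br_self i := by rw [D.br_self, C_0]
  br_antisymm i j := by rw [D.br_antisymm, C_neg]
  br_mul_self i j := by rw [← C_mul, D.br_mul_self, C_0]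
  br_commute h1 h2 h3 h4 := (D.br_commute h1 h2 h3 h4).map C
  three_term h1 h2 h3 := by
    rw [← C_mul, ← C_mul, ← C_mul, ← C_add, ← C_add, D.three_term h1 h2 h3, C_0]
  br_commute_x h1 h2 := ((D.br_commute_x h1 h2).map C).add_right (commute_X _).symm
  br_mul_x {i j} h := by
    rw [mul_add, add_mul, ← C_mul, ← C_mul, D.br_mul_x h, C_sub, X_mul]
    abel
  br_commute_t i j := (D.br_commute_t i j).map C
  x_commute i j := (((D.x_commute i j).map C).add_left (commute_X _)).add_right
    ((commute_X _).symm.add_left (Commute.refl _))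
  x_commute_t i := ((D.x_commute_t i).map C).add_left (commute_X _)

omit [DecidableEq ι] in
theorem shift_matchWeight (p : ℕ) : D.shift.matchWeight p = Polynomial.C (D.matchWeight p) := by
  induction p using Nat.twoStepInduction with
  | zero => simp [matchWeight]
  | one => simp [matchWeight]
  | more p ih _ =>
    rw [matchWeight, matchWeight, ih, map_nsmul, map_mul, map_neg]
    rfl

omit [DecidableEq ι] in
theorem shift_theta (K : Finset ι) :
    D.shift.theta K = fun i => Polynomial.C (D.theta K i) + Polynomial.X := by
  funext i
  simp only [theta, shift, map_add, map_sum]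
  abel

open Polynomial in
/-- The elementary symmetric functions of the Dunkl elements, in terms of those of the `x_i`. -/
theorem sum_powersetCard_commProd_theta (K : Finset ι)
    (hK : ∀ i j, Commute (D.theta K i) (D.theta K j)) (k : ℕ) (hk : k ≤ K.card) :
    ∑ T ∈ K.powersetCard k, commProd (D.theta K) hK T
      = ∑ p ∈ Finset.range (k + 1), (K.card - k + p).choose p •
          (D.matchWeight p * ∑ T ∈ K.powersetCard (k - p), commProd D.x D.x_commute T) := by
  have hg : ∀ i j, Commute (C (D.theta K i) + X) (C (D.theta K j) + X) := fun i j =>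
    (((hK i j).map C).add_left (commute_X _)).add_right
      ((commute_X _).symm.add_left (Commute.refl _))
  have hg' : ∀ i j, Commute (D.shift.theta K i) (D.shift.theta K j) := by
    rw [D.shift_theta]; exact hg
  have main : commProd (fun i => C (D.theta K i) + X) hg K = D.shift.matchSum K := by
    rw [← D.shift.commProd_theta K hg']
    congr 1
    exact (D.shift_theta K).symm
  rw [commProd_C_add_X _ hK] at main
  have sub : ∀ S : Finset ι, commProd D.shift.x D.shift.x_commute S
      = ∑ T ∈ S.powerset, C (commProd D.x D.x_commute T) * X ^ (S \ T).card := fun S =>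
    commProd_C_add_X D.x D.x_commute D.shift.x_commute S
  -- On the left, the subsets contributing to this coefficient are exactly those of size `k`.
  have e := congrArg (fun q : A[X] => q.coeff (K.card - k)) main
  simp only [matchSum, sub, D.shift_matchWeight, finsetSum_coeff, coeff_C_mul, coeff_X_pow] at e
  have lhs : ∑ T ∈ K.powerset, commProd (D.theta K) hK T
        * (if K.card - k = (K \ T).card then 1 else 0)
      = ∑ T ∈ K.powersetCard k, commProd (D.theta K) hK T := by
    rw [Finset.powersetCard_eq_filter, Finset.sum_filter]
    refine Finset.sum_congr rfl fun T hT => ?_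
    have h1 := Finset.card_sdiff_add_card_eq_card (Finset.mem_powerset.1 hT)
    rw [mul_ite, mul_one, mul_zero]
    exact if_congr (by omega) rfl rfl
  have inner : ∀ T ∈ K.powerset, ∑ S ∈ (K \ T).powerset, D.matchWeight S.card
        * (commProd D.x D.x_commute T * if K.card - k = ((K \ S) \ T).card then 1 else 0)
      = if T.card ≤ k then (K.card - T.card).choose (k - T.card) •
        (D.matchWeight (k - T.card) * commProd D.x D.x_commute T) else 0 := fun T hT => by
    have hc := Finset.card_sdiff_add_card_eq_card (Finset.mem_powerset.1 hT)
    have h : ∀ S ∈ (K \ T).powerset, D.matchWeight S.card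
        * (commProd D.x D.x_commute T * if K.card - k = ((K \ S) \ T).card then 1 else 0)
        = if S.card + T.card = k then
          D.matchWeight (k - T.card) * commProd D.x D.x_commute T else 0 := fun S hS => by
      have hc' := Finset.card_sdiff_add_card_eq_card (Finset.mem_powerset.1 hS)
      rw [sdiff_right_comm]
      by_cases h : S.card + T.card = k
      · rw [if_pos h, if_pos (by omega), mul_one, ← h, Nat.add_sub_cancel]
      · rw [if_neg h, if_neg (by omega), mul_zero, mul_zero]
    rw [Finset.sum_congr rfl h]
    -- With the unmatched set `T` fixed, the matched set is any subset of `K \ T` of size `k -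
    -- T.card`; counting these gives the binomial coefficient.
    split_ifs with hT'
    · rw [← Finset.sum_filter, Finset.filter_congr (q := fun S => S.card = k - T.card)
        (fun S _ => by omega), ← Finset.powersetCard_eq_filter, Finset.sum_const,
        Finset.card_powersetCard, ← hc, Nat.add_sub_cancel]
    · exact Finset.sum_eq_zero fun S _ => if_neg (by omega)
  rw [lhs] at e
  rw [e]
  simp only [Finset.mul_sum]
  rw [Finset.sum_comm' (t' := K.powerset) (s' := fun T => (K \ T).powerset) (fun S T => by
      simp only [Finset.mem_powerset, Finset.subset_sdiff, disjoint_comm]; tauto),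
    Finset.sum_congr rfl inner, Finset.sum_powerset]
  have h : ∀ j ∈ Finset.range (K.card + 1), (∑ T ∈ K.powersetCard j,
        if T.card ≤ k then (K.card - T.card).choose (k - T.card) •
        (D.matchWeight (k - T.card) * commProd D.x D.x_commute T) else 0)
      = if j ≤ k then (K.card - j).choose (k - j) •
        (D.matchWeight (k - j) * ∑ T ∈ K.powersetCard j, commProd D.x D.x_commute T) else 0 :=
    fun j _ => by
      rw [Finset.sum_congr rfl fun T hT => by rw [(Finset.mem_powersetCard.1 hT).2]]
      split_ifs
      · rw [← Finset.smul_sum, ← Finset.mul_sum]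
      · simp
  rw [Finset.sum_congr rfl h, ← Finset.sum_filter,
    show (Finset.range (K.card + 1)).filter (· ≤ k) = Finset.range (k + 1) by
      ext j; simp only [Finset.mem_filter, Finset.mem_range]; omega,
    ← Finset.sum_range_reflect]
  refine Finset.sum_congr rfl fun p hp => ?_
  rw [Finset.mem_range] at hp
  rw [← Finset.mul_sum, show k + 1 - 1 - p = k - p by omega, show k - (k - p) = p by omega,
    show K.card - (k - p) = K.card - k + p by omega]

omit [DecidableEq ι] in
theorem matchWeight_two_mul (r : ℕ) :
    D.matchWeight (2 * r) = (-D.t) ^ r * ((Nat.doubleFactorial (2 * r - 1) : ℕ) : A) := by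
  induction r with
  -- Truncated subtraction makes the double factorial `0!! = 1` here.
  | zero => simp [matchWeight]
  | succ r ih =>
    rw [show 2 * (r + 1) = 2 * r + 2 by ring, matchWeight, ih,
      show 2 * r + 2 - 1 = 2 * r + 1 by omega, Nat.doubleFactorial_add_one, nsmul_eq_mul, pow_succ',
      Nat.cast_mul, mul_assoc, (Nat.cast_commute (2 * r + 1) (-D.t)).left_comm,
      (Nat.cast_commute (2 * r + 1) ((-D.t) ^ r)).left_comm]

omit [DecidableEq ι] in
theorem matchWeight_two_mul_add_one (r : ℕ) : D.matchWeight (2 * r + 1) = 0 := by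
  induction r with
  | zero => rfl
  | succ r ih => rw [show 2 * (r + 1) + 1 = 2 * r + 1 + 2 by ring, matchWeight, ih]; simp

end BracketSystem

/-! ### Specialization to the extended quadratic algebra. -/

namespace ExtAlg

theorem mk_eq_of_rel {n : ℕ} {a b : ExtFree n} (h : ExtRel n a b) : mk n a = mk n b :=
  RingQuot.mkAlgHom_rel (YRing n) h

theorem br_antisymm {n : ℕ} (i j : Fin n) (h : i ≠ j) : br i j h = -br j i h.symm := by
  simpa [br] using mk_eq_of_rel (ExtRel.antisymm i j h)

/-- The bracket `[i,j]`, extended by `0` to the diagonal. -/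
noncomputable def brExt {n : ℕ} (i j : Fin n) : ExtAlg n := if h : i ≠ j then br i j h else 0

theorem brExt_of_ne {n : ℕ} {i j : Fin n} (h : i ≠ j) : brExt i j = br i j h := dif_pos h

theorem brExt_self {n : ℕ} (i : Fin n) : brExt i i = 0 := dif_neg (by simp)

theorem brExt_antisymm {n : ℕ} (i j : Fin n) : brExt i j = -brExt j i := by
  rcases eq_or_ne i j with rfl | h
  · simp [brExt_self]
  · rw [brExt_of_ne h, brExt_of_ne h.symm, br_antisymm]

/-- The generators of the extended quadratic algebra as a bracket system. -/
noncomputable def bracketSystem (n : ℕ) : BracketSystem (Fin n) (ExtAlg n) where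
  br := brExt
  x := x
  t := t
  br_self := brExt_self
  br_antisymm := brExt_antisymm
  br_mul_self i j := by
    rcases eq_or_ne i j with rfl | h
    · simp [brExt_self]
    · simpa [brExt_of_ne h, br] using mk_eq_of_rel (ExtRel.sq i j h)
  br_commute {i j k l} h1 h2 h3 h4 := by
    rcases eq_or_ne i j with rfl | h
    · simp [brExt_self]
    rcases eq_or_ne k l with rfl | h'
    · simp [brExt_self]
    simpa [brExt_of_ne h, brExt_of_ne h', br, Commute, SemiconjBy] using
      mk_eq_of_rel (ExtRel.br_comm i j k l h h' h1 h2 h3 h4)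
  three_term {i j k} h1 h2 h3 := by
    simpa [brExt_of_ne h1, brExt_of_ne h2, brExt_of_ne h3, br] using
      mk_eq_of_rel (ExtRel.three_term i j k h1 h2 h3)
  br_commute_x {i j k} h1 h2 := by
    rcases eq_or_ne i j with rfl | h
    · simp [brExt_self]
    simpa [brExt_of_ne h, br, x, Commute, SemiconjBy] using
      mk_eq_of_rel (ExtRel.br_x i j k h h1 h2)
  br_mul_x {i j} h := by
    -- Antisymmetry merges the two relations stated for `i < j` into one valid for all `i ≠ j`, with
    -- the same sign of `t`.
    rcases lt_or_gt_of_ne h with h' | h'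
    · simpa [brExt_of_ne h, br, x, t] using mk_eq_of_rel (ExtRel.br_x_right i j h')
    · have : brExt j i * x j = x i * brExt j i + t := by
        simpa [brExt_of_ne h.symm, br, x, t] using mk_eq_of_rel (ExtRel.br_x_left j i h')
      rw [brExt_antisymm i j, neg_mul, this]
      noncomm_ring
  br_commute_t i j := by
    rcases eq_or_ne i j with rfl | h
    · simp [brExt_self]
    simpa [brExt_of_ne h, br, t, Commute, SemiconjBy] using mk_eq_of_rel (ExtRel.br_t i j h)
  x_commute i j := by
    simpa [x, Commute, SemiconjBy] using mk_eq_of_rel (ExtRel.x_comm i j)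
  x_commute_t i := by
    simpa [x, t, Commute, SemiconjBy] using mk_eq_of_rel (ExtRel.x_t i)

theorem sum_commProd_x (n k : ℕ) (hk : k ≤ n) :
    ∑ T ∈ (Finset.univ : Finset (Fin n)).powersetCard k,
      commProd (bracketSystem n).x (bracketSystem n).x_commute T = esymmY n k := by
  have h : ∑ T ∈ (Finset.univ : Finset (Fin n)).powersetCard k,
      commProd (bracketSystem n).x (bracketSystem n).x_commute T = mk n (ExtFree.esymmX n k) := by
    rw [ExtFree.esymmX, map_sum]
    refine Finset.sum_congr rfl fun T _ => ?_
    rw [map_list_prod, List.map_map,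
      commProd_eq_prod_map _ _ (T.sort_nodup (fun a b => a ≤ b)) (T.sort_toFinset _)]
    rfl
  rw [h, esymmY, if_neg (by omega), Int.toNat_natCast]
  -- The defining relations start at degree one; in degree zero both sides are `1`.
  rcases Nat.eq_zero_or_pos k with rfl | h0
  · simp [ExtFree.esymmX]
  · rw [mk_eq_of_rel (ExtRel.esymm k h0 hk), AlgHom.commutes]

end ExtAlg

theorem corollary2p1 (n k : ℕ) (hk : 1 ≤ k) (hkn : k ≤ n) :
    ExtAlg.esymmDunkl n k =
      ExtAlg.esymmY n k +
        ∑ r ∈ Finset.Icc 1 k,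
          (-ExtAlg.t) ^ r *
            ((Nat.doubleFactorial (2 * r - 1) * Nat.choose (n - k + 2 * r) (2 * r) : ℕ) :
              ExtAlg n) *
            ExtAlg.esymmY n ((k : ℤ) - 2 * (r : ℤ)) := by
  set D := ExtAlg.bracketSystem n
  set f : ℕ → ExtAlg n := fun r => (-ExtAlg.t) ^ r *
            ((Nat.doubleFactorial (2 * r - 1) * Nat.choose (n - k + 2 * r) (2 * r) : ℕ) :
              ExtAlg n) *
            ExtAlg.esymmY n ((k : ℤ) - 2 * (r : ℤ)) with hf
  -- With all indices allowed as partners, `D.theta` unfolds to `ExtAlg.dunkl`.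
  have h := D.sum_powersetCard_commProd_theta Finset.univ ExtAlg.dunkl_commute k (by simpa)
  rw [Finset.card_univ, Fintype.card_fin] at h
  have h0 : ExtAlg.esymmY n k = f 0 := by simp [hf]
  rw [h0, ← Finset.sum_insert (by simp),
    show insert 0 (Finset.Icc 1 k) = Finset.range (k + 1) by
      ext r; simp only [Finset.mem_insert, Finset.mem_Icc, Finset.mem_range]; omega]
  refine h.trans ?_
  have even : ∀ r, 2 * r ≤ k → (n - k + 2 * r).choose (2 * r) •
      (D.matchWeight (2 * r) * ∑ T ∈ (Finset.univ : Finset (Fin n)).powersetCard (k - 2 * r),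
        commProd D.x D.x_commute T) = f r := fun r hr => by
    rw [ExtAlg.sum_commProd_x n _ (by omega), D.matchWeight_two_mul]
    simp only [hf]
    rw [Nat.cast_mul,
      Nat.cast_sub hr, nsmul_eq_mul, ← mul_assoc, (Nat.cast_commute _ _).eq, ← mul_assoc]
    push_cast
    rfl
  -- The terms with `2 * r > k` vanish, since `esymmY` is zero in negative degree.
  rw [← Finset.sum_filter_add_sum_filter_not (Finset.range (k + 1)) (fun r => 2 * r ≤ k) f,
    Finset.sum_eq_zero (s := (Finset.range (k + 1)).filter fun r => ¬ 2 * r ≤ k), add_zero]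
  · symm
    -- Only even `p = 2 * r` contribute: a set of odd size has no perfect matching.
    refine Finset.sum_bij_ne_zero (fun r _ _ => 2 * r) ?_ ?_ ?_ ?_
    · intro r hr _
      simp only [Finset.mem_filter, Finset.mem_range] at hr ⊢
      omega
    · intro r _ _ s _ _ hrs
      simpa using hrs
    · intro p hp hne
      rcases Nat.even_or_odd' p with ⟨r, rfl | rfl⟩
      · rw [Finset.mem_range] at hp
        refine ⟨r, by simp only [Finset.mem_filter, Finset.mem_range]; omega, ?_, rfl⟩
        rwa [← even r (by omega)]
      · exact absurd (by rw [D.matchWeight_two_mul_add_one, zero_mul, smul_zero]) hne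
    · intro r hr _
      exact (even r (Finset.mem_filter.1 hr).2).symm
  · intro r hr
    have hr := (Finset.mem_filter.1 hr).2
    rw [hf]
    simp only
    rw [ExtAlg.esymmY, if_pos (by omega), mul_zero]
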